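/- Let $1<\alpha\le 2$, $\gamma>0$, $\tau>0$, let $a<b$ be real numbers, let $M$ be an even positive integer, and put $h=(b-a)/(M+1)$ and $\mu=\gamma\tau/h^{\alpha}$. For $k\in\mathbb Z$ let $$c_k=\frac{(-1)^k\,\Gamma(\alpha+1)}{\Gamma(\alpha/2-k+1)\,\Gamma(\alpha/2+k+1)}$$ (with $1/\Gamma=0$ at the poles of $\Gamma$), and let $$\theta=\frac{\left(1-\frac{1+\alpha}{5+\alpha/2}\right)^{5+\alpha/2}e^{1+\alpha}\,\Gamma(\alpha+1)\sin(\pi\alpha/2)}{\pi\alpha}.$$ Let $T=\mu\,(c_{i-j})_{1\le i,j\le M}$ be the symmetric Toeplitz matrix with these coefficients (the discrete fractional Laplacian), and let $C$ be its Strang circulant approximation, i.e. the symmetric circulant $M\times M$ matrix with first column $\mu\,(c_0,c_1,\dots,c_{M/2-1},0,c_{M/2-1},\dots,c_1)^{\top}$. (i) If $M\ge 4$, then every eigenvalue $\lambda_T$ of $T$ satisfies $$\frac{2\gamma\tau\theta}{(b-a)^{\alpha}}<\lambda_T<\frac{2\gamma\tau}{h^{\alpha}}\left[\frac{\Gamma(\alpha+1)}{\Gamma(\alpha/2+1)^2}-\frac{\theta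 h^{\alpha}}{(b-a)^{\alpha}}\right].$$ (ii) If $M\ge 8$ and $\alpha<2$, then every eigenvalue $\lambda_C$ of $C$ satisfies $$\frac{2^{\alpha+1}\gamma\tau\theta}{(b-a)^{\alpha}}<\lambda_C<\frac{2\gamma\tau}{h^{\alpha}}\left[\frac{\Gamma(\alpha+1)}{\Gamma(\alpha/2+1)^2}-\frac{2^{\alpha}\theta h^{\alpha}}{(b-a)^{\alpha}}\right].$$ -/

import Mathlib

namespace FracLap

/-- The coefficients `c_k = (-1)^k Γ(α+1) / (Γ(α/2-k+1) Γ(α/2+k+1))`, `k ∈ ℤ`, of the fractional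
centered difference. `Real.Gamma` is `0` at the poles of `Γ`, so that `c_k = 0` whenever the
denominator has a pole, in agreement with the usual convention `1/Γ = 0` there. -/
noncomputable def coeff (α : ℝ) (k : ℤ) : ℝ :=
  (-1 : ℝ) ^ k * Real.Gamma (α + 1) /
    (Real.Gamma (α / 2 - (k : ℝ) + 1) * Real.Gamma (α / 2 + (k : ℝ) + 1))

/-- The spatial step size `h = (b - a) / (M + 1)`. -/
noncomputable def stepSize (a b : ℝ) (M : ℕ) : ℝ := (b - a) / ((M : ℝ) + 1)

/-- The scaling factor `μ = γ τ / h^α`. -/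
noncomputable def scale (α γ τ a b : ℝ) (M : ℕ) : ℝ := γ * τ / stepSize a b M ^ α

/-- The discrete fractional Laplacian: the `M × M` Toeplitz matrix `T = μ (c_{i-j})`. -/
noncomputable def toeplitzT (α γ τ a b : ℝ) (M : ℕ) : Matrix (Fin M) (Fin M) ℝ :=
  Matrix.of fun i j => scale α γ τ a b M * coeff α ((i : ℤ) - (j : ℤ))

/-- The first column of Strang's circulant approximation, without the factor `μ`:
`c_0, c_1, …, c_{M/2-1}, 0, c_{M/2-1}, …, c_1` when `M` is even. -/
noncomputable def strangColumn (α : ℝ) (M : ℕ) (k : Fin M) : ℝ :=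
  if 2 * (k : ℕ) < M then coeff α (k : ℤ)
  else if 2 * (k : ℕ) = M then 0
  else coeff α ((M : ℤ) - (k : ℤ))

/-- Strang's circulant approximation `C` of the discrete fractional Laplacian; subtraction of the
indices in `Matrix.circulant` is modulo `M`. -/
noncomputable def strangC (α γ τ a b : ℝ) (M : ℕ) : Matrix (Fin M) (Fin M) ℝ :=
  scale α γ τ a b M • Matrix.circulant (strangColumn α M)

/-- The constant
`θ = (1 - (1+α)/(5+α/2))^(5+α/2) e^(1+α) Γ(α+1) sin(πα/2) / (πα)`. -/
noncomputable def theta (α : ℝ) : ℝ :=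
  (1 - (1 + α) / (5 + α / 2)) ^ (5 + α / 2) * Real.exp (1 + α) * Real.Gamma (α + 1) *
    Real.sin (Real.pi * α / 2) / (Real.pi * α)

end FracLap

namespace FracLap

/-! Off-diagonal entries are nonpositive, so Gershgorin traps each eigenvalue between some row sum
and twice the diagonal entry minus that sum. Row sums reduce to S_m = ∑_{|k| ≤ m} c_k, which
telescope (`symmSum_mul`) to a multiple of Γ(m+1-α/2)/Γ(m+1+α/2) (`symmSum_eq_Gamma`). Log-convexity
of Γ bounds this ratio below by (m+1)^(-α), giving `theta_lt_symmSum`. At α = 2, θ = 0 and some row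
sums may vanish; strictness then comes from chained dominance (`exists_eigenvalue_mem_Ioo`). -/

/-! ### Coefficients and their symmetric partial sums -/

lemma coeff_neg (α : ℝ) (k : ℤ) : coeff α (-k) = coeff α k := by
  unfold coeff
  rw [zpow_neg, ← inv_zpow, inv_neg_one]
  push_cast
  rw [mul_comm (Real.Gamma (α / 2 - -(k : ℝ) + 1)), sub_neg_eq_add, ← sub_eq_add_neg]

lemma coeff_zero (α : ℝ) :
    coeff α 0 = Real.Gamma (α + 1) / Real.Gamma (α / 2 + 1) ^ 2 := by
  simp [coeff, sq]

lemma coeff_zero_pos {α : ℝ} (hα : 0 < α) : 0 < coeff α 0 := by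
  rw [coeff_zero]
  have h1 := Real.Gamma_pos_of_pos (show 0 < α + 1 by linarith)
  have h2 := Real.Gamma_pos_of_pos (show 0 < α / 2 + 1 by linarith)
  positivity

lemma coeff_succ_mul {α : ℝ} (hα : 0 < α) (k : ℕ) :
    coeff α ((k : ℤ) + 1) * ((k : ℝ) + 1 + α / 2) = coeff α k * ((k : ℝ) - α / 2) := by
  have hk : (0 : ℝ) ≤ k := k.cast_nonneg
  have hpos : 0 < α / 2 + (k : ℝ) + 1 := by linarith
  have hG := (Real.Gamma_pos_of_pos hpos).ne'
  have hrec : Real.Gamma (α / 2 + ((k : ℝ) + 1) + 1) =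
      (α / 2 + (k : ℝ) + 1) * Real.Gamma (α / 2 + (k : ℝ) + 1) := by
    rw [← Real.Gamma_add_one hpos.ne']; ring_nf
  have hz : (-1 : ℝ) ^ ((k : ℤ) + 1) = -(-1 : ℝ) ^ (k : ℤ) := by
    rw [zpow_add₀ (by norm_num)]; simp
  unfold coeff
  push_cast
  rw [hz, hrec, show α / 2 - ((k : ℝ) + 1) + 1 = α / 2 - k by ring,
    show (k : ℝ) + 1 + α / 2 = α / 2 + k + 1 by ring, ← neg_sub (α / 2)]
  generalize α / 2 + (k : ℝ) + 1 = t at *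
  generalize α / 2 - (k : ℝ) = s
  -- At a pole of Γ both sides are 0, since `Real.Gamma` and division by zero return 0.
  by_cases hs : s = 0
  · simp [hs]
  · rw [Real.Gamma_add_one hs]
    by_cases hΓ : Real.Gamma s = 0
    · simp [hΓ]
    · field_simp

/-- The factor k - α/2 of the recurrence is negative only at k = 0, because α ≤ 2. -/
lemma coeff_succ_nonpos {α : ℝ} (hα : 0 < α) (hα2 : α ≤ 2) (k : ℕ) :
    coeff α ((k : ℤ) + 1) ≤ 0 := by
  induction k with
  | zero =>
    have h := coeff_succ_mul hα 0
    have h0 := coeff_zero_pos hα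
    simp only [Nat.cast_zero, zero_add, zero_sub] at h ⊢
    by_contra hc
    push Not at hc
    nlinarith [mul_pos hc (show 0 < 1 + α / 2 by linarith), mul_pos h0 hα]
  | succ k ih =>
    have h := coeff_succ_mul hα (k + 1)
    push_cast at h ⊢
    have hk : (0 : ℝ) ≤ k := k.cast_nonneg
    have h1 : coeff α ((k : ℤ) + 1) * ((k : ℝ) + 1 - α / 2) ≤ 0 :=
      mul_nonpos_of_nonpos_of_nonneg ih (by linarith)
    rw [← h] at h1
    exact nonpos_of_mul_nonpos_left h1 (by linarith)

lemma coeff_nonpos {α : ℝ} (hα : 0 < α) (hα2 : α ≤ 2) {k : ℤ} (hk : k ≠ 0) :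
    coeff α k ≤ 0 := by
  obtain ⟨n, rfl | rfl⟩ := k.eq_nat_or_neg
  all_goals
    obtain ⟨m, rfl⟩ := Nat.exists_eq_succ_of_ne_zero (n := n) (by rintro rfl; simp at hk)
  · exact_mod_cast coeff_succ_nonpos hα hα2 m
  · rw [coeff_neg]
    exact_mod_cast coeff_succ_nonpos hα hα2 m

/-- The symmetric partial sum `∑_{|k| ≤ m} c_k`. -/
noncomputable def symmSum (α : ℝ) (m : ℕ) : ℝ :=
  coeff α 0 + 2 * ∑ k ∈ Finset.range m, coeff α ((k : ℤ) + 1)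

lemma symmSum_mul {α : ℝ} (hα : 0 < α) (m : ℕ) :
    α / 2 * symmSum α m = -(coeff α ((m : ℤ) + 1) * ((m : ℝ) + 1 + α / 2)) := by
  induction m with
  | zero =>
    rw [coeff_succ_mul hα 0]
    simp [symmSum]
    ring
  | succ m ih =>
    rw [coeff_succ_mul hα (m + 1)]
    simp only [symmSum, Finset.sum_range_succ] at ih ⊢
    push_cast
    linear_combination ih

lemma symmSum_nonneg {α : ℝ} (hα : 0 < α) (hα2 : α ≤ 2) (m : ℕ) : 0 ≤ symmSum α m := by
  have h : 0 ≤ α / 2 * symmSum α m := by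
    rw [symmSum_mul hα]
    have := mul_nonpos_of_nonpos_of_nonneg (coeff_succ_nonpos hα hα2 m)
      (show 0 ≤ (m : ℝ) + 1 + α / 2 by positivity)
    linarith
  exact nonneg_of_mul_nonneg_right h (by linarith)

/-- The base case is Euler's reflection formula; the induction step is the recurrence for c_k. -/
lemma symmSum_eq_Gamma {α : ℝ} (hα : 0 < α) (hα2 : α < 2) (m : ℕ) :
    α / 2 * symmSum α m = Real.Gamma (α + 1) * Real.sin (Real.pi * α / 2) / Real.pi *
      (Real.Gamma ((m : ℝ) + 1 - α / 2) / Real.Gamma ((m : ℝ) + 1 + α / 2)) := by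
  induction m with
  | zero =>
    have hr := Real.Gamma_mul_Gamma_one_sub (α / 2)
    have hs : 0 < Real.sin (Real.pi * (α / 2)) :=
      Real.sin_pos_of_pos_of_lt_pi (by positivity) (by nlinarith [Real.pi_pos])
    have h1 := Real.Gamma_pos_of_pos (show 0 < α / 2 by linarith)
    have hr' : Real.Gamma (1 - α / 2) =
        Real.pi / Real.sin (Real.pi * (α / 2)) / Real.Gamma (α / 2) := by
      rw [← hr]; field_simp
    simp only [symmSum, Finset.range_zero, Finset.sum_empty, mul_zero, add_zero, Nat.cast_zero,
      zero_add]
    rw [coeff_zero, hr', add_comm 1 (α / 2), Real.Gamma_add_one (s := α / 2) (by positivity),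
      mul_div_assoc Real.pi]
    generalize Real.sin (Real.pi * (α / 2)) = σ at *
    generalize Real.Gamma (α / 2) = g at *
    have := Real.pi_pos
    field_simp
  | succ m ih =>
    rw [symmSum_mul hα, coeff_succ_mul hα (m + 1)]
    rw [symmSum_mul hα] at ih
    have hm : (0 : ℝ) ≤ m := m.cast_nonneg
    have h1 : 0 < (m : ℝ) + 1 - α / 2 := by linarith
    have h2 : 0 < (m : ℝ) + 1 + α / 2 := by linarith
    have hG := Real.Gamma_pos_of_pos h2
    push_cast
    rw [show (m : ℝ) + 1 + 1 - α / 2 = ((m : ℝ) + 1 - α / 2) + 1 by ring,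
      show (m : ℝ) + 1 + 1 + α / 2 = ((m : ℝ) + 1 + α / 2) + 1 by ring,
      Real.Gamma_add_one h1.ne', Real.Gamma_add_one h2.ne', mul_div_mul_comm,
      mul_left_comm, ← ih]
    field_simp

/-! ### Lower bound for the partial sums -/

/-- Log-convexity of `Γ` on an interval of unit length. -/
lemma Gamma_add_le_mul_rpow {x s : ℝ} (hx : 0 < x) (hs : 0 < s) (hs1 : s < 1) :
    Real.Gamma (x + s) ≤ Real.Gamma x * x ^ s := by
  have h := Real.Gamma_mul_add_mul_le_rpow_Gamma_mul_rpow_Gamma hx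
    (show 0 < x + 1 by linarith) (show 0 < 1 - s by linarith) hs (by ring)
  have hG := Real.Gamma_pos_of_pos hx
  rw [show (1 - s) * x + s * (x + 1) = x + s by ring, Real.Gamma_add_one hx.ne',
    Real.mul_rpow hx.le hG.le, mul_left_comm, ← Real.rpow_add hG] at h
  simpa [mul_comm] using h

lemma rpow_neg_le_Gamma_div_Gamma {x s : ℝ} (hs : 0 < s) (hs1 : s < 1) (hsx : s < x) :
    x ^ (-(2 * s)) ≤ Real.Gamma (x - s) / Real.Gamma (x + s) := by
  have hx : 0 < x := hs.trans hsx
  have hd : 0 < x - s := by linarith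
  have h1 := Gamma_add_le_mul_rpow hx hs hs1
  have h2 := Gamma_add_le_mul_rpow hd hs hs1
  rw [sub_add_cancel] at h2
  have hG := Real.Gamma_pos_of_pos hd
  have hp := Real.Gamma_pos_of_pos (show 0 < x + s by linarith)
  have h3 : (x - s) ^ s ≤ x ^ s := Real.rpow_le_rpow hd.le (by linarith) hs.le
  have hxs : 0 < x ^ s := Real.rpow_pos_of_pos hx s
  rw [Real.rpow_neg hx.le, two_mul, Real.rpow_add hx, le_div_iff₀ hp,
    inv_mul_le_iff₀ (by positivity)]
  calc Real.Gamma (x + s) ≤ Real.Gamma x * x ^ s := h1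
    _ ≤ (Real.Gamma (x - s) * (x - s) ^ s) * x ^ s := by gcongr
    _ ≤ (Real.Gamma (x - s) * x ^ s) * x ^ s := by gcongr
    _ = _ := by ring

/-- By 1 - t ≤ e^(-t) with t = (1+α)/(5+α/2), the first two factors of θ have product at most 1. -/
lemma theta_le {α : ℝ} (hα : 0 < α) (hα2 : α ≤ 2) :
    α * theta α ≤ Real.Gamma (α + 1) * Real.sin (Real.pi * α / 2) / Real.pi := by
  have h0 : 0 < 5 + α / 2 := by linarith
  have h1 : 0 ≤ 1 - (1 + α) / (5 + α / 2) := by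
    rw [sub_nonneg, div_le_one h0]; linarith
  have h2 : 0 ≤ Real.sin (Real.pi * α / 2) :=
    Real.sin_nonneg_of_nonneg_of_le_pi (by positivity) (by nlinarith [Real.pi_pos])
  have h3 := Real.Gamma_pos_of_pos (show 0 < α + 1 by linarith)
  have h4 : (1 - (1 + α) / (5 + α / 2)) ^ (5 + α / 2) * Real.exp (1 + α) ≤ 1 := by
    have h := Real.rpow_le_rpow h1 (Real.one_sub_le_exp_neg ((1 + α) / (5 + α / 2))) h0.le
    rw [← Real.exp_mul, neg_mul, div_mul_cancel₀ _ h0.ne'] at h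
    calc _ ≤ Real.exp (-(1 + α)) * Real.exp (1 + α) := by gcongr
      _ = 1 := by rw [← Real.exp_add]; simp
  have hpi := Real.pi_pos
  have : α * theta α = ((1 - (1 + α) / (5 + α / 2)) ^ (5 + α / 2) * Real.exp (1 + α)) *
      (Real.Gamma (α + 1) * Real.sin (Real.pi * α / 2) / Real.pi) := by
    unfold theta; field_simp
  rw [this]
  exact mul_le_of_le_one_left (by positivity) h4

lemma theta_two : theta 2 = 0 := by simp [theta]

/-- Used with x = M+1 for T and x = (M+1)/2 for C; strictness comes from m+1 < x. -/
lemma theta_lt_symmSum {α : ℝ} (hα : 0 < α) (hα2 : α < 2) {m : ℕ} {x : ℝ}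
    (hx : (m : ℝ) + 1 < x) : 2 * theta α / x ^ α < symmSum α m := by
  have hm : (0 : ℝ) ≤ m := m.cast_nonneg
  have hs : 0 < Real.sin (Real.pi * α / 2) :=
    Real.sin_pos_of_pos_of_lt_pi (by positivity) (by nlinarith [Real.pi_pos])
  have hΓ := Real.Gamma_pos_of_pos (show 0 < α + 1 by linarith)
  have hx0 : 0 < x := by linarith
  have hpi := Real.pi_pos
  have hlow := rpow_neg_le_Gamma_div_Gamma (x := (m : ℝ) + 1) (s := α / 2)
    (by linarith) (by linarith) (by linarith)
  rw [show 2 * (α / 2) = α by ring] at hlow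
  have hlt : x ^ (-α) < ((m : ℝ) + 1) ^ (-α) :=
    Real.rpow_lt_rpow_of_neg (by linarith) hx (by linarith)
  have hxp : 0 < x ^ (-α) := Real.rpow_pos_of_pos hx0 _
  have key : α * theta α * x ^ (-α) < α / 2 * symmSum α m := by
    rw [symmSum_eq_Gamma hα hα2]
    calc α * theta α * x ^ (-α)
        ≤ Real.Gamma (α + 1) * Real.sin (Real.pi * α / 2) / Real.pi * x ^ (-α) := by
          gcongr
          exact theta_le hα hα2.le
      _ < _ := by
          apply mul_lt_mul_of_pos_left (hlt.trans_le hlow)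
          positivity
  rw [div_eq_mul_inv, ← Real.rpow_neg hx0.le]
  have h2 : α / 2 * (2 * theta α * x ^ (-α)) < α / 2 * symmSum α m := by linarith
  exact lt_of_mul_lt_mul_left h2 (by linarith)

/-! ### Gershgorin bounds -/

section Gershgorin

variable {n : Type*} [Fintype n] [DecidableEq n]

lemma sum_erase_abs_eq {A : Matrix n n ℝ} (hA : ∀ i j, i ≠ j → A i j ≤ 0) (i : n) :
    ∑ j ∈ Finset.univ.erase i, |A i j| = A i i - ∑ j, A i j := by
  rw [← Finset.add_sum_erase _ _ (Finset.mem_univ i), sub_add_cancel_left,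
    ← Finset.sum_neg_distrib]
  refine Finset.sum_congr rfl fun j hj => abs_of_nonpos (hA i j ?_)
  exact (Finset.ne_of_mem_erase hj).symm

/-- Gershgorin's theorem for a real matrix with nonpositive off-diagonal entries. -/
lemma exists_rowSum_le_eigenvalue {A : Matrix n n ℝ} (hA : ∀ i j, i ≠ j → A i j ≤ 0) {lam : ℝ}
    (h : Module.End.HasEigenvalue (Matrix.toLin' A) lam) :
    ∃ i, ∑ j, A i j ≤ lam ∧ lam ≤ 2 * A i i - ∑ j, A i j := by
  obtain ⟨i, hi⟩ := eigenvalue_mem_ball h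
  refine ⟨i, ?_⟩
  simp only [Real.norm_eq_abs] at hi
  rw [sum_erase_abs_eq hA, Metric.mem_closedBall, Real.dist_eq, abs_le] at hi
  constructor <;> linarith [hi.1, hi.2]

/-- A strict form of Gershgorin's theorem for weakly chained diagonally dominant matrices. -/
lemma exists_eigenvalue_mem_Ioo [LinearOrder n] {A : Matrix n n ℝ}
    (hA : ∀ i j, i ≠ j → A i j ≤ 0) (hrow : ∀ i, 0 ≤ ∑ j, A i j)
    (hchain : ∀ i, 0 < ∑ j, A i j ∨ ∃ j < i, A i j < 0) {lam : ℝ}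
    (h : Module.End.HasEigenvalue (Matrix.toLin' A) lam) :
    ∃ i, 0 < lam ∧ lam < 2 * A i i := by
  obtain ⟨v, hv⟩ := h.exists_hasEigenvector
  have hv0 : v ≠ 0 := hv.2
  have hAv : A.mulVec v = lam • v := by
    simpa [Matrix.toLin'_apply] using hv.apply_eq_smul
  obtain ⟨k, hk⟩ := Function.ne_iff.mp hv0
  obtain ⟨i₀, -, hi₀⟩ := Finset.exists_max_image Finset.univ (fun i => |v i|) ⟨k, Finset.mem_univ k⟩
  have hne : (Finset.univ.filter fun i => ∀ j, |v j| ≤ |v i|).Nonempty :=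
    ⟨i₀, by simpa using hi₀⟩
  -- The least index maximizing |v i|: any earlier entry is strictly smaller, so a nonzero `A i j`
  -- with j < i makes the estimate strict.
  obtain ⟨i, hi, hmin⟩ := Finset.exists_min_image _ id hne
  simp only [Finset.mem_filter, Finset.mem_univ, true_and, id] at hi hmin
  have hlt : ∀ j < i, |v j| < |v i| := by
    intro j hj
    refine lt_of_le_of_ne (hi j) fun he => ?_
    exact absurd (hmin j fun l => he ▸ hi l) (not_le.mpr hj)
  have hpos : 0 < |v i| := (abs_pos.mpr hk).trans_le (hi k)
  have hsum : (lam - A i i) * v i = ∑ j ∈ Finset.univ.erase i, A i j * v j := by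
    have := congrFun hAv i
    simp only [Matrix.mulVec, dotProduct, Pi.smul_apply, smul_eq_mul] at this
    rw [← Finset.add_sum_erase _ _ (Finset.mem_univ i)] at this
    linarith
  have hle : |lam - A i i| * |v i| ≤ ∑ j ∈ Finset.univ.erase i, |A i j| * |v j| := by
    rw [← abs_mul, hsum]
    simpa only [abs_mul] using Finset.abs_sum_le_sum_abs (fun j => A i j * v j) _
  have hS := sum_erase_abs_eq hA i
  have hterm : ∀ j ∈ Finset.univ.erase i, |A i j| * |v j| ≤ |A i j| * |v i| := fun j _ =>
    mul_le_mul_of_nonneg_left (hi j) (abs_nonneg _)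
  have hstrict : |lam - A i i| * |v i| < A i i * |v i| := by
    rcases hchain i with hc | ⟨j, hj, hc⟩
    · calc _ ≤ _ := hle
        _ ≤ ∑ j ∈ Finset.univ.erase i, |A i j| * |v i| := Finset.sum_le_sum hterm
        _ = (A i i - ∑ j, A i j) * |v i| := by rw [← Finset.sum_mul, hS]
        _ < _ := mul_lt_mul_of_pos_right (by linarith) hpos
    · calc _ ≤ _ := hle
        _ < ∑ j ∈ Finset.univ.erase i, |A i j| * |v i| :=
          Finset.sum_lt_sum hterm ⟨j, Finset.mem_erase.mpr ⟨hj.ne, Finset.mem_univ j⟩,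
            mul_lt_mul_of_pos_left (hlt j hj) (abs_pos.mpr hc.ne)⟩
        _ = (A i i - ∑ j, A i j) * |v i| := by rw [← Finset.sum_mul, hS]
        _ ≤ _ := mul_le_mul_of_nonneg_right (by linarith [hrow i]) hpos.le
  have h2 := abs_lt.mp (lt_of_mul_lt_mul_right hstrict hpos.le)
  exact ⟨i, by linarith [h2.1], by linarith [h2.2]⟩

end Gershgorin

/-! ### Scaling -/

lemma scale_pos {α γ τ a b : ℝ} (M : ℕ) (hγ : 0 < γ) (hτ : 0 < τ) (hab : a < b) :
    0 < scale α γ τ a b M := by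
  have : 0 < b - a := sub_pos.mpr hab
  unfold scale stepSize
  positivity

lemma stepSize_rpow {α a b : ℝ} (M : ℕ) (hab : a < b) :
    stepSize a b M ^ α = (b - a) ^ α / ((M : ℝ) + 1) ^ α := by
  rw [stepSize, Real.div_rpow (sub_pos.mpr hab).le (by positivity)]

lemma scale_mul_div {α γ τ a b : ℝ} (M : ℕ) (hab : a < b) (c : ℝ) :
    scale α γ τ a b M * (c / ((M : ℝ) + 1) ^ α) = γ * τ * c / (b - a) ^ α := by
  have h1 : 0 < (b - a) ^ α := Real.rpow_pos_of_pos (sub_pos.mpr hab) α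
  have h2 : 0 < ((M : ℝ) + 1) ^ α := by positivity
  rw [scale, stepSize_rpow M hab]
  field_simp

/-- Here c is θ for T and 2^α θ for C. -/
lemma bounds_of_scale {α γ τ a b c lam d : ℝ} (M : ℕ) (hab : a < b)
    (hlow : scale α γ τ a b M * (2 * c / ((M : ℝ) + 1) ^ α) < lam)
    (hup : lam < 2 * (scale α γ τ a b M * d) -
      scale α γ τ a b M * (2 * c / ((M : ℝ) + 1) ^ α)) :
    2 * γ * τ * c / (b - a) ^ α < lam ∧
      lam < 2 * γ * τ / stepSize a b M ^ α *
        (d - c * stepSize a b M ^ α / (b - a) ^ α) := by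
  have h1 : 0 < (b - a) ^ α := Real.rpow_pos_of_pos (sub_pos.mpr hab) α
  have h2 : 0 < ((M : ℝ) + 1) ^ α := by positivity
  constructor
  · rw [scale_mul_div M hab] at hlow
    convert hlow using 2
    ring
  · refine hup.trans_eq ?_
    rw [scale, stepSize_rpow M hab]
    field_simp

/-! ### The Toeplitz matrix -/

lemma toeplitzT_apply_nonpos {α γ τ a b : ℝ} {M : ℕ} (hα : 0 < α) (hα2 : α ≤ 2) (hγ : 0 < γ)
    (hτ : 0 < τ) (hab : a < b) (i j : Fin M) (hij : i ≠ j) :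
    toeplitzT α γ τ a b M i j ≤ 0 := by
  refine mul_nonpos_of_nonneg_of_nonpos (scale_pos M hγ hτ hab).le (coeff_nonpos hα hα2 ?_)
  intro h
  exact hij (Fin.ext (by omega))

/-- Row i has i entries left of the diagonal and M-1-i right of it; each side is half of a symmetric
sum. -/
lemma sum_coeff_sub (α : ℝ) {M : ℕ} (i : Fin M) :
    ∑ j : Fin M, coeff α ((i : ℤ) - (j : ℤ)) =
      (symmSum α i + symmSum α (M - 1 - i)) / 2 := by
  obtain ⟨l, hl⟩ : ∃ l, M = (i : ℕ) + 1 + l := ⟨M - 1 - i, by omega⟩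
  rw [Fin.sum_univ_eq_sum_range (fun j : ℕ => coeff α ((i : ℤ) - (j : ℤ))) M]
  rw [show M - 1 - (i : ℕ) = l by omega, congrArg Finset.range hl, Finset.sum_range_add,
    Finset.sum_range_succ, ← Finset.sum_range_reflect]
  have e1 : ∑ j ∈ Finset.range (i : ℕ), coeff α ((i : ℤ) - (((i : ℕ) - 1 - j : ℕ) : ℤ)) =
      ∑ j ∈ Finset.range (i : ℕ), coeff α ((j : ℤ) + 1) := by
    refine Finset.sum_congr rfl fun j hj => ?_
    have := Finset.mem_range.mp hj
    congr 1
    omega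
  have e2 : ∑ j ∈ Finset.range l, coeff α ((i : ℤ) - (((i : ℕ) + 1 + j : ℕ) : ℤ)) =
      ∑ j ∈ Finset.range l, coeff α ((j : ℤ) + 1) := by
    refine Finset.sum_congr rfl fun j _ => ?_
    rw [← coeff_neg]
    congr 1
    push_cast
    ring
  rw [e1, e2, sub_self]
  unfold symmSum
  ring

lemma toeplitzT_rowSum (α γ τ a b : ℝ) {M : ℕ} (i : Fin M) :
    ∑ j, toeplitzT α γ τ a b M i j =
      scale α γ τ a b M * ((symmSum α i + symmSum α (M - 1 - i)) / 2) := by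
  simp only [toeplitzT, Matrix.of_apply]
  rw [← Finset.mul_sum, sum_coeff_sub]

lemma toeplitzT_eigenvalue_bounds {α γ τ a b lam : ℝ} {M : ℕ} (hα : 0 < α) (hα2 : α < 2)
    (hγ : 0 < γ) (hτ : 0 < τ) (hab : a < b)
    (h : Module.End.HasEigenvalue (Matrix.toLin' (toeplitzT α γ τ a b M)) lam) :
    scale α γ τ a b M * (2 * theta α / ((M : ℝ) + 1) ^ α) < lam ∧
      lam < 2 * (scale α γ τ a b M * coeff α 0) -
        scale α γ τ a b M * (2 * theta α / ((M : ℝ) + 1) ^ α) := by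
  obtain ⟨i, h1, h2⟩ :=
    exists_rowSum_le_eigenvalue (toeplitzT_apply_nonpos hα hα2.le hγ hτ hab) h
  rw [toeplitzT_rowSum] at h1 h2
  have hii : toeplitzT α γ τ a b M i i = scale α γ τ a b M * coeff α 0 := by
    simp [toeplitzT]
  rw [hii] at h2
  have hlt (m : ℕ) (hm : m < M) : 2 * theta α / ((M : ℝ) + 1) ^ α < symmSum α m :=
    theta_lt_symmSum hα hα2 (by exact_mod_cast Nat.succ_lt_succ hm)
  have hs := mul_lt_mul_of_pos_left
    (show 2 * theta α / ((M : ℝ) + 1) ^ α < (symmSum α i + symmSum α (M - 1 - i)) / 2 by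
      linarith [hlt i i.2, hlt (M - 1 - i) (by omega)])
    (scale_pos (α := α) M hγ hτ hab)
  constructor <;> linarith

/-- The matrix is tridiagonal: row 0 has positive sum, and every other row is linked to its
predecessor by c_1 = -c_0/2 < 0. -/
lemma toeplitzT_two_eigenvalue_bounds {γ τ a b lam : ℝ} {M : ℕ}
    (hγ : 0 < γ) (hτ : 0 < τ) (hab : a < b)
    (h : Module.End.HasEigenvalue (Matrix.toLin' (toeplitzT 2 γ τ a b M)) lam) :
    0 < lam ∧ lam < 2 * (scale 2 γ τ a b M * coeff 2 0) := by
  have hsc := scale_pos (α := 2) M hγ hτ hab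
  have h0 := coeff_zero_pos (α := 2) two_pos
  have hrow (i : Fin M) : 0 ≤ ∑ j, toeplitzT 2 γ τ a b M i j := by
    rw [toeplitzT_rowSum]
    have := symmSum_nonneg (α := 2) two_pos le_rfl i
    have := symmSum_nonneg (α := 2) two_pos le_rfl (M - 1 - i)
    positivity
  have hchain (i : Fin M) : 0 < ∑ j, toeplitzT 2 γ τ a b M i j ∨
      ∃ j < i, toeplitzT 2 γ τ a b M i j < 0 := by
    rcases Nat.eq_zero_or_pos (i : ℕ) with hi | hi
    · left
      rw [toeplitzT_rowSum, hi]
      have : symmSum 2 0 = coeff 2 0 := by simp [symmSum]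
      have := symmSum_nonneg (α := 2) two_pos le_rfl (M - 1 - 0)
      apply mul_pos hsc
      linarith
    · right
      refine ⟨⟨i - 1, by omega⟩, Fin.lt_def.mpr (by simp; omega), mul_neg_of_pos_of_neg hsc ?_⟩
      have h3 := coeff_succ_mul (α := 2) two_pos 0
      norm_num at h3
      rw [show ((i : ℕ) : ℤ) - (((⟨i - 1, by omega⟩ : Fin M) : ℕ) : ℤ) = 1 by simp; omega]
      linarith
  obtain ⟨i, h1, h2⟩ := exists_eigenvalue_mem_Ioo
    (toeplitzT_apply_nonpos two_pos le_rfl hγ hτ hab) hrow hchain h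
  refine ⟨h1, h2.trans_eq ?_⟩
  simp [toeplitzT]

/-! ### The Strang circulant -/

lemma sum_strangColumn (α : ℝ) {N : ℕ} (hN : 0 < N) :
    ∑ k : Fin (2 * N), strangColumn α (2 * N) k = symmSum α (N - 1) := by
  obtain ⟨n, rfl⟩ := Nat.exists_eq_succ_of_ne_zero hN.ne'
  obtain ⟨f, hf⟩ : ∃ f : ℕ → ℝ, f = fun k : ℕ =>
    if 2 * k < 2 * (n + 1) then coeff α (k : ℤ)
    else if 2 * k = 2 * (n + 1) then 0
    else coeff α (((2 * (n + 1) : ℕ) : ℤ) - (k : ℤ)) := ⟨_, rfl⟩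
  have hF : ∑ k : Fin (2 * (n + 1)), strangColumn α (2 * (n + 1)) k =
      ∑ k ∈ Finset.range (2 * (n + 1)), f k := by
    rw [← Fin.sum_univ_eq_sum_range, hf]
    rfl
  have h0 : f 0 = coeff α 0 := by simp [hf]
  have hmid : f (n + 1) = 0 := by simp [hf]
  have hleft : ∀ k ∈ Finset.range n, f (k + 1) = coeff α ((k : ℤ) + 1) := by
    intro k hk
    have := Finset.mem_range.mp hk
    simp only [hf]
    rw [if_pos (by omega)]
    push_cast
    rfl
  have hright : ∀ k ∈ Finset.range n,
      f (n + 1 + (n - 1 - k + 1)) = coeff α ((k : ℤ) + 1) := by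
    intro k hk
    have := Finset.mem_range.mp hk
    simp only [hf]
    rw [if_neg (by omega), if_neg (by omega)]
    congr 1
    omega
  -- Split before the middle zero and reflect the second half.
  rw [hF, show 2 * (n + 1) = (n + 1) + (n + 1) by ring, Finset.sum_range_add,
    Finset.sum_range_succ', Finset.sum_range_succ', Finset.sum_congr rfl hleft,
    ← Finset.sum_range_reflect (fun k => f (n + 1 + (k + 1))), Finset.sum_congr rfl hright, h0, add_zero, hmid]
  simp only [symmSum, Nat.succ_eq_add_one, Nat.add_sub_cancel]
  ring

lemma strangC_apply_nonpos {α γ τ a b : ℝ} {M : ℕ} (hα : 0 < α) (hα2 : α ≤ 2) (hγ : 0 < γ)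
    (hτ : 0 < τ) (hab : a < b) (i j : Fin M) (hij : i ≠ j) :
    strangC α γ τ a b M i j ≤ 0 := by
  have : NeZero M := ⟨by have := i.2; omega⟩
  rw [strangC, Matrix.smul_apply, smul_eq_mul, Matrix.circulant_apply]
  refine mul_nonpos_of_nonneg_of_nonpos (scale_pos M hγ hτ hab).le ?_
  have hk : i - j ≠ 0 := sub_ne_zero.mpr hij
  have hk0 : ((i - j : Fin M) : ℕ) ≠ 0 := fun h => hk (Fin.ext (by simpa using h))
  have hkM := (i - j).2
  unfold strangColumn
  split_ifs
  · exact coeff_nonpos hα hα2 (by exact_mod_cast hk0)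
  · exact le_rfl
  · exact coeff_nonpos hα hα2 (by omega)

lemma strangC_rowSum (α γ τ a b : ℝ) {N : ℕ} (hN : 0 < N) (i : Fin (2 * N)) :
    ∑ j, strangC α γ τ a b (2 * N) i j = scale α γ τ a b (2 * N) * symmSum α (N - 1) := by
  have : NeZero (2 * N) := ⟨by omega⟩
  simp only [strangC, Matrix.smul_apply, smul_eq_mul, Matrix.circulant_apply]
  rw [← Finset.mul_sum, ← sum_strangColumn α hN]
  exact congrArg _ ((Equiv.subLeft i).sum_comp (strangColumn α (2 * N)))

lemma strangC_apply_self (α γ τ a b : ℝ) {M : ℕ} (i : Fin M) :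
    strangC α γ τ a b M i i = scale α γ τ a b M * coeff α 0 := by
  have hM : 0 < M := i.pos
  have : NeZero M := ⟨hM.ne'⟩
  simp [strangC, Matrix.circulant_apply, strangColumn, hM]

lemma strangC_eigenvalue_bounds {α γ τ a b lam : ℝ} {N : ℕ} (hα : 0 < α) (hα2 : α < 2)
    (hγ : 0 < γ) (hτ : 0 < τ) (hab : a < b) (hN : 0 < N)
    (h : Module.End.HasEigenvalue (Matrix.toLin' (strangC α γ τ a b (2 * N))) lam) :
    scale α γ τ a b (2 * N) * (2 * ((2 : ℝ) ^ α * theta α) / (((2 * N : ℕ) : ℝ) + 1) ^ α) < lam ∧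
      lam < 2 * (scale α γ τ a b (2 * N) * coeff α 0) - scale α γ τ a b (2 * N) *
        (2 * ((2 : ℝ) ^ α * theta α) / (((2 * N : ℕ) : ℝ) + 1) ^ α) := by
  obtain ⟨i, h1, h2⟩ :=
    exists_rowSum_le_eigenvalue (strangC_apply_nonpos hα hα2.le hγ hτ hab) h
  rw [strangC_rowSum _ _ _ _ _ hN] at h1 h2
  rw [strangC_apply_self] at h2
  -- Here m+1 = N = M/2 < (M+1)/2; the halved base yields the factor 2^α.
  have hlt : 2 * theta α / ((((2 * N : ℕ) : ℝ) + 1) / 2) ^ α < symmSum α (N - 1) := by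
    refine theta_lt_symmSum hα hα2 ?_
    rw [Nat.cast_sub hN]
    push_cast
    linarith
  have heq : 2 * ((2 : ℝ) ^ α * theta α) / (((2 * N : ℕ) : ℝ) + 1) ^ α =
      2 * theta α / ((((2 * N : ℕ) : ℝ) + 1) / 2) ^ α := by
    rw [Real.div_rpow (by positivity) (by positivity)]
    field_simp
  rw [heq]
  have hs := mul_lt_mul_of_pos_left hlt (scale_pos (α := α) (2 * N) hγ hτ hab)
  constructor <;> linarith

end FracLap

theorem lemma4p2 (α γ τ a b : ℝ) (M : ℕ) (hα1 : 1 < α) (hα2 : α ≤ 2)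
    (hγ : 0 < γ) (hτ : 0 < τ) (hab : a < b) (hM : Even M) :
    (4 ≤ M → ∀ lam : ℝ,
      Module.End.HasEigenvalue (Matrix.toLin' (FracLap.toeplitzT α γ τ a b M)) lam →
        2 * γ * τ * FracLap.theta α / (b - a) ^ α < lam ∧
        lam < 2 * γ * τ / FracLap.stepSize a b M ^ α *
          (Real.Gamma (α + 1) / Real.Gamma (α / 2 + 1) ^ 2 -
            FracLap.theta α * FracLap.stepSize a b M ^ α / (b - a) ^ α)) ∧
    (8 ≤ M → α < 2 → ∀ lam : ℝ,
      Module.End.HasEigenvalue (Matrix.toLin' (FracLap.strangC α γ τ a b M)) lam →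
        (2 : ℝ) ^ (α + 1) * γ * τ * FracLap.theta α / (b - a) ^ α < lam ∧
        lam < 2 * γ * τ / FracLap.stepSize a b M ^ α *
          (Real.Gamma (α + 1) / Real.Gamma (α / 2 + 1) ^ 2 -
            (2 : ℝ) ^ α * FracLap.theta α * FracLap.stepSize a b M ^ α / (b - a) ^ α)) := by
  have hα : 0 < α := by linarith
  rw [← FracLap.coeff_zero]
  constructor
  · intro _ lam h
    apply FracLap.bounds_of_scale M hab
    · rcases hα2.lt_or_eq with hlt | rfl
      · exact (FracLap.toeplitzT_eigenvalue_bounds hα hlt hγ hτ hab h).1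
      · simpa [FracLap.theta_two] using (FracLap.toeplitzT_two_eigenvalue_bounds hγ hτ hab h).1
    · rcases hα2.lt_or_eq with hlt | rfl
      · exact (FracLap.toeplitzT_eigenvalue_bounds hα hlt hγ hτ hab h).2
      · simpa [FracLap.theta_two] using (FracLap.toeplitzT_two_eigenvalue_bounds hγ hτ hab h).2
  · intro hM8 hlt lam h
    obtain ⟨N, rfl⟩ := hM.two_dvd
    obtain ⟨h1, h2⟩ :=
      FracLap.strangC_eigenvalue_bounds hα hlt hγ hτ hab (by omega) h
    have hb := FracLap.bounds_of_scale (2 * N) hab h1 h2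
    refine ⟨?_, hb.2⟩
    convert hb.1 using 2
    rw [Real.rpow_add_one two_ne_zero]
    ring
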